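/- Let $G$ be a finite group, and write $|x|$ for the order of an element $x\in G$ and $[a,b]=a^{-1}b^{-1}ab$. The $\delta^*_k$-commutators of $G$ are defined recursively: every element of $G$ is a $\delta^*_0$-commutator; for $k\ge 1$, an element $g\in G$ is a $\delta^*_k$-commutator if $g=[a,b]$ for some $a,b\in G$ with $(|a|,|b|)=1$, each of which is a power of a $\delta^*_{k-1}$-commutator of $G$. Let $\delta^*_k(G)$ denote the subgroup of $G$ generated by all $\delta^*_k$-commutators of $G$. Proposition. Let $G$ be a finite soluble group and let $k\ge 1$ be an integer. If $|ab|=|a|\,|b|$ whenever $a$ and $b$ are $\delta^*_k$-commutators of $G$ such that $(|a|,|b|)=1$, then $\delta^*_k(G)$ is nilpotent. -/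

import Mathlib

/-- The set of `δ*ₖ`-commutators of a group `G`. Every element is a `δ*₀`-commutator; `g` is a
`δ*ₖ₊₁`-commutator iff `g = [a, b] = a⁻¹ b⁻¹ a b` with `a`, `b` powers of `δ*ₖ`-commutators
and `(|a|, |b|) = 1`. -/
def deltaStarCommutators (G : Type*) [Group G] : ℕ → Set G
  | 0 => Set.univ
  | k + 1 => {g | ∃ a b : G,
      (∃ x ∈ deltaStarCommutators G k, ∃ m : ℤ, a = x ^ m) ∧
      (∃ y ∈ deltaStarCommutators G k, ∃ n : ℤ, b = y ^ n) ∧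
      Nat.Coprime (orderOf a) (orderOf b) ∧ g = a⁻¹ * b⁻¹ * a * b}

/-- The subgroup `δ*ₖ(G)` generated by all `δ*ₖ`-commutators of `G`. -/
def deltaStar (G : Type*) [Group G] (k : ℕ) : Subgroup G :=
  Subgroup.closure (deltaStarCommutators G k)

/-! Repeatedly passing to the subgroup generated by commutators of coprime-order elements gives
`coprimeSeries`, which contains `deltaStar` termwise and is preserved by surjections of finite
groups. If its term `k + 1` is trivial, coprime elements of `deltaStar G k` commute, so that group
is nilpotent.

Otherwise `hasActingTower_of_coprimeSeries_ne_bot` gives a tower of `k + 2` subgroups of prime-power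
order whose first member acts nontrivially all the way down. The order hypothesis forbids this
(`mem_towerKer_of_orderOf_mul`). Going down, Engel commutators turn a δ*ᵢ-commutator of one entry
into a δ*ᵢ₊₁-commutator of the next. At the last entry the acting `x` is a δ*ₖ-commutator, and
`x[e,x]⁻¹` is a conjugate of `x`; hence `|x| |[e,x]| = |x|` and `[e,x] = 1`. Coprime action carries
triviality back up: if `[u,x,…,x]` acts trivially on the rest of the tower, so does `[u,x]`. -/

/-- The commutator `[a, b] = a⁻¹ b⁻¹ a b`. -/
def rightComm {G : Type*} [Group G] (a b : G) : G := a⁻¹ * b⁻¹ * a * b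

/-! ### Commutator identities and coprime action -/

section rightComm

variable {G : Type*} [Group G]

theorem rightComm_inv (a b : G) : (rightComm a b)⁻¹ = rightComm b a := by
  simp [rightComm, mul_assoc]

theorem rightComm_eq_one_iff {a b : G} : rightComm a b = 1 ↔ a * b = b * a := by
  rw [rightComm, show a⁻¹ * b⁻¹ * a * b = (b * a)⁻¹ * (a * b) by group, inv_mul_eq_one, eq_comm]

theorem map_rightComm {H : Type*} [Group H] (f : G →* H) (a b : G) :
    f (rightComm a b) = rightComm (f a) (f b) := by
  simp [rightComm]

theorem rightComm_mem {H : Subgroup G} {a b : G} (ha : a ∈ H) (hb : b ∈ H) :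
    rightComm a b ∈ H :=
  H.mul_mem (H.mul_mem (H.mul_mem (H.inv_mem ha) (H.inv_mem hb)) ha) hb

theorem rightComm_mem_of_mem_normalizer {P : Subgroup G} {u x : G} (hu : u ∈ P)
    (hx : x ∈ Subgroup.normalizer (P : Set G)) : rightComm u x ∈ P := by
  have h := (Subgroup.mem_normalizer_iff.1 (Subgroup.inv_mem _ hx) u).1 hu
  rw [rightComm, show u⁻¹ * x⁻¹ * u * x = u⁻¹ * (x⁻¹ * u * x⁻¹⁻¹) by group]
  exact P.mul_mem (P.inv_mem hu) h

/-- If `[u, x]` commutes with `x`, then `[u, x]` is killed by the order of `x`. -/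
theorem rightComm_pow_orderOf_eq_one {u x : G}
    (h : rightComm (rightComm u x) x = 1) : rightComm u x ^ orderOf x = 1 := by
  have hc : Commute (rightComm u x) x := rightComm_eq_one_iff.1 h
  have key : ∀ n : ℕ, u * x ^ n = x ^ n * (u * rightComm u x ^ n) := by
    intro n
    induction n with
    | zero => simp
    | succ n ih =>
      have h1 : u * x = x * (u * rightComm u x) := by simp [rightComm]; group
      rw [pow_succ, ← mul_assoc, ih, mul_assoc, mul_assoc, (hc.pow_left n).eq, ← mul_assoc u, h1,
        pow_succ']
      simp only [mul_assoc]
  have := key (orderOf x)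
  simpa using this

/-- Modulo `M`, inside its normalizer, `[u,x]` commutes with `x`, so its order divides both `|x|`
and `|[u,x]|`, which are coprime. -/
theorem rightComm_mem_of_rightComm_rightComm_mem {M : Subgroup G} {u x : G}
    (hu : u ∈ Subgroup.normalizer (M : Set G)) (hx : x ∈ Subgroup.normalizer (M : Set G))
    (hco : (orderOf x).Coprime (orderOf (rightComm u x)))
    (h : rightComm (rightComm u x) x ∈ M) : rightComm u x ∈ M := by
  let H := Subgroup.normalizer (M : Set G)
  let u' : H := ⟨u, hu⟩
  let x' : H := ⟨x, hx⟩
  let π := QuotientGroup.mk' (M.subgroupOf H)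
  have hπ : ∀ y : H, π y = 1 ↔ (y : G) ∈ M := fun y => by
    rw [QuotientGroup.mk'_apply, QuotientGroup.eq_one_iff, Subgroup.mem_subgroupOf]
  have hval : ∀ a b : H, ((rightComm a b : H) : G) = rightComm (a : G) b := fun a b => rfl
  have h1 : rightComm (rightComm (π u') (π x')) (π x') = 1 := by
    rw [← map_rightComm, ← map_rightComm, hπ]
    exact h
  have h2 := rightComm_pow_orderOf_eq_one h1
  rw [← map_rightComm] at h2
  have h3 : orderOf (π (rightComm u' x')) ∣ orderOf x :=
    (orderOf_dvd_of_pow_eq_one h2).trans ((orderOf_map_dvd π x').trans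
      (by rw [← Subgroup.orderOf_coe]))
  have h4 : orderOf (π (rightComm u' x')) ∣ orderOf (rightComm u x) :=
    (orderOf_map_dvd π _).trans (by rw [← Subgroup.orderOf_coe, hval])
  have h5 := Nat.eq_one_of_dvd_coprimes hco h3 h4
  rw [orderOf_eq_one_iff, hπ, hval] at h5
  exact h5

/-- The Engel commutator `[u, x, …, x]` with `n` entries `x`. -/
def engelComm (u x : G) : ℕ → G
  | 0 => u
  | n + 1 => rightComm (engelComm u x n) x

theorem engelComm_mem {P : Subgroup G} {u x : G} (hu : u ∈ P)
    (hx : x ∈ Subgroup.normalizer (P : Set G)) (n : ℕ) : engelComm u x n ∈ P := by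
  induction n with
  | zero => exact hu
  | succ n ih => exact rightComm_mem_of_mem_normalizer ih hx

/-- A coprime element acting in an Engel fashion on `P` modulo `M` acts trivially. -/
theorem rightComm_mem_of_engelComm_mem {P M : Subgroup G} {u x : G} (hu : u ∈ P)
    (hx : x ∈ Subgroup.normalizer (P : Set G)) (hPM : P ≤ Subgroup.normalizer (M : Set G))
    (hxM : x ∈ Subgroup.normalizer (M : Set G))
    (hco : ∀ v ∈ P, (orderOf x).Coprime (orderOf v)) {n : ℕ}
    (h : engelComm u x (n + 1) ∈ M) : rightComm u x ∈ M := by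
  induction n with
  | zero => exact h
  | succ n ih =>
    refine ih (rightComm_mem_of_rightComm_rightComm_mem (hPM (engelComm_mem hu hx n)) hxM ?_ h)
    exact hco _ (engelComm_mem hu hx (n + 1))

end rightComm

/-! ### δ*-commutators and the order hypothesis -/

section deltaStar

variable {G : Type*} [Group G]

theorem rightComm_mem_deltaStarCommutators {k : ℕ} {a b : G}
    (ha : a ∈ deltaStarCommutators G k) (hb : b ∈ deltaStarCommutators G k)
    (hco : (orderOf a).Coprime (orderOf b)) : rightComm a b ∈ deltaStarCommutators G (k + 1) :=
  ⟨a, b, ⟨a, ha, 1, by simp⟩, ⟨b, hb, 1, by simp⟩, hco, rfl⟩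

theorem inv_mem_deltaStarCommutators {k : ℕ} {g : G} (hg : g ∈ deltaStarCommutators G (k + 1)) :
    g⁻¹ ∈ deltaStarCommutators G (k + 1) := by
  obtain ⟨a, b, ha, hb, hco, rfl⟩ := hg
  exact ⟨b, a, hb, ha, hco.symm, rightComm_inv a b⟩

theorem deltaStarCommutators_antitone : Antitone (deltaStarCommutators G) := by
  refine antitone_nat_of_succ_le fun k => ?_
  induction k with
  | zero => exact fun _ _ => Set.mem_univ _
  | succ k ih =>
    rintro g ⟨a, b, ⟨x, hx, m, rfl⟩, ⟨y, hy, n, rfl⟩, hco, rfl⟩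
    exact ⟨_, _, ⟨x, ih hx, m, rfl⟩, ⟨y, ih hy, n, rfl⟩, hco, rfl⟩

/-- The Engel commutators stay in `P`, hence coprime to `x`, so each further entry `x` raises the
level by one until the level of `x` itself is used up. -/
theorem engelComm_mem_deltaStarCommutators {k : ℕ} {P : Subgroup G} {u x : G} (hu : u ∈ P)
    (hx : x ∈ Subgroup.normalizer (P : Set G)) (hxk : x ∈ deltaStarCommutators G k)
    (hco : ∀ v ∈ P, (orderOf x).Coprime (orderOf v)) {n : ℕ} (hn : n ≤ k + 1) :
    engelComm u x n ∈ deltaStarCommutators G n := by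
  induction n with
  | zero => exact Set.mem_univ _
  | succ n ih =>
    exact rightComm_mem_deltaStarCommutators (ih (by omega))
      (deltaStarCommutators_antitone (by omega) hxk) (hco _ (engelComm_mem hu hx n)).symm

/-- Under the hypothesis on orders, a `δ*ₖ`-commutator centralizes every subgroup it normalizes
whose elements have order coprime to its own. -/
theorem rightComm_eq_one_of_orderOf_mul [Finite G] {k : ℕ} (hk : 1 ≤ k)
    (h : ∀ a ∈ deltaStarCommutators G k, ∀ b ∈ deltaStarCommutators G k,
      Nat.Coprime (orderOf a) (orderOf b) → orderOf (a * b) = orderOf a * orderOf b)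
    {P : Subgroup G} {u x : G} (hu : u ∈ P) (hx : x ∈ Subgroup.normalizer (P : Set G))
    (hxk : x ∈ deltaStarCommutators G k)
    (hco : ∀ v ∈ P, (orderOf x).Coprime (orderOf v)) : rightComm u x = 1 := by
  obtain ⟨k, rfl⟩ : ∃ j, k = j + 1 := ⟨k - 1, by omega⟩
  set e := engelComm u x k
  have he : engelComm u x (k + 1) = rightComm e x := rfl
  have hmem : rightComm e x ∈ deltaStarCommutators G (k + 1) :=
    engelComm_mem_deltaStarCommutators hu hx hxk hco (by omega)
  have hP : rightComm e x ∈ P := engelComm_mem hu hx (k + 1)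
  -- The inverse is taken so that the product `x[e,x]⁻¹` is a conjugate of `x`.
  have h1 := h x hxk _ (inv_mem_deltaStarCommutators hmem)
    (by rw [orderOf_inv]; exact hco _ hP)
  have h2 : x * (rightComm e x)⁻¹ = MulAut.conj e⁻¹ x := by
    simp [rightComm, mul_assoc]
  have h3 : orderOf (MulAut.conj e⁻¹ x) = orderOf x := MulEquiv.orderOf_eq _ _
  rw [h2, h3, orderOf_inv] at h1
  have h4 : orderOf (rightComm e x) = 1 :=
    by
    simpa [(orderOf_pos x).ne'] using h1
  rw [orderOf_eq_one_iff] at h4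
  have := rightComm_mem_of_engelComm_mem (M := ⊥) (n := k) hu hx
    (by rw [Subgroup.normalizer_eq_top]; exact le_top)
    (by rw [Subgroup.normalizer_eq_top]; exact Subgroup.mem_top x) hco
    (by rw [he, h4]; exact Subgroup.one_mem _)
  simpa using this

end deltaStar

/-! ### The coprime commutator series -/

section coprimeSeries

/-- The series obtained from a group by iterating the subgroup generated by all commutators of
elements of coprime orders. -/
def coprimeSeries (G : Type*) [Group G] : ℕ → Subgroup G
  | 0 => ⊤
  | n + 1 => Subgroup.closure {g | ∃ a ∈ coprimeSeries G n, ∃ b ∈ coprimeSeries G n,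
      (orderOf a).Coprime (orderOf b) ∧ g = rightComm a b}

variable {G : Type*} [Group G]

theorem rightComm_mem_coprimeSeries {n : ℕ} {a b : G} (ha : a ∈ coprimeSeries G n)
    (hb : b ∈ coprimeSeries G n) (hco : (orderOf a).Coprime (orderOf b)) :
    rightComm a b ∈ coprimeSeries G (n + 1) :=
  Subgroup.subset_closure ⟨a, ha, b, hb, hco, rfl⟩

theorem deltaStar_le_coprimeSeries (n : ℕ) : deltaStar G n ≤ coprimeSeries G n := by
  refine (Subgroup.closure_le _).2 ?_
  induction n with
  | zero => exact fun _ _ => Subgroup.mem_top _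
  | succ n ih =>
    rintro g ⟨a, b, ⟨x, hx, m, rfl⟩, ⟨y, hy, l, rfl⟩, hco, rfl⟩
    exact rightComm_mem_coprimeSeries (Subgroup.zpow_mem _ (ih hx) m)
      (Subgroup.zpow_mem _ (ih hy) l) hco

theorem coprimeSeries_antitone : Antitone (coprimeSeries G) := by
  refine antitone_nat_of_succ_le fun n => (Subgroup.closure_le _).2 ?_
  rintro g ⟨a, ha, b, hb, -, rfl⟩
  exact rightComm_mem ha hb

theorem coprimeSeries_le_derivedSeries (n : ℕ) : coprimeSeries G n ≤ derivedSeries G n := by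
  induction n with
  | zero => exact le_top
  | succ n ih =>
    refine (Subgroup.closure_le _).2 ?_
    rintro g ⟨a, ha, b, hb, -, rfl⟩
    have h := Subgroup.commutator_mem_commutator (Subgroup.inv_mem _ (ih ha))
      (Subgroup.inv_mem _ (ih hb))
    rwa [commutatorElement_def, inv_inv, inv_inv] at h

/-- Replacing an element by a power with the same image, one may assume that only primes dividing
the order of the image divide the order of the element. -/
theorem exists_pow_map_eq_of_prime_dvd {H : Type*} [Group H] [Finite G] (f : G →* H) (a : G) :
    ∃ s : ℕ, f (a ^ s) = f a ∧ ∀ q : ℕ, q.Prime → q ∣ orderOf (a ^ s) → q ∣ orderOf (f a) := by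
  classical
  have hex : ∃ N s : ℕ, f (a ^ s) = f a ∧ orderOf (a ^ s) = N := ⟨_, 1, by simp, rfl⟩
  obtain ⟨s, hs, hN⟩ := Nat.find_spec hex
  refine ⟨s, hs, fun q hq hqs => ?_⟩
  by_contra hqf
  have hco : (orderOf (f a)).Coprime q := ((Nat.Prime.coprime_iff_not_dvd hq).2 hqf).symm
  -- The `t`-th power fixes `f a`, as `t ≡ 1` modulo its order, but lowers the minimal order, as `q
  -- ∣ t`.
  obtain ⟨t, ht1, ht2⟩ := Nat.chineseRemainder hco 1 0
  have hlt : orderOf (a ^ (s * t)) < Nat.find hex := by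
    rw [← hN, pow_mul, orderOf_pow]
    refine Nat.div_lt_self (orderOf_pos _) ?_
    have hd : q ∣ (orderOf (a ^ s)).gcd t := Nat.dvd_gcd hqs ((Nat.modEq_zero_iff_dvd).1 ht2)
    exact hq.one_lt.trans_le (Nat.le_of_dvd (Nat.gcd_pos_of_pos_left _ (orderOf_pos _)) hd)
  refine Nat.find_min hex hlt ⟨s * t, ?_, rfl⟩
  rw [pow_mul, map_pow, hs]
  simpa using (pow_eq_pow_iff_modEq (x := f a)).2 ht1

/-- Coprime-order elements of the image lift to coprime-order elements, so the generating
commutators lift. -/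
theorem map_coprimeSeries {H : Type*} [Group H] [Finite G] (f : G →* H)
    (hf : Function.Surjective f) (n : ℕ) : (coprimeSeries G n).map f = coprimeSeries H n := by
  induction n with
  | zero => exact Subgroup.map_top_of_surjective f hf
  | succ n ih =>
    refine le_antisymm ?_ ?_
    · rw [Subgroup.map_le_iff_le_comap]
      refine (Subgroup.closure_le _).2 ?_
      rintro g ⟨a, ha, b, hb, hco, rfl⟩
      show f (rightComm a b) ∈ coprimeSeries H (n + 1)
      rw [map_rightComm]
      refine rightComm_mem_coprimeSeries (ih ▸ Subgroup.mem_map_of_mem f ha)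
        (ih ▸ Subgroup.mem_map_of_mem f hb) ?_
      exact Nat.Coprime.of_dvd (orderOf_map_dvd f a) (orderOf_map_dvd f b) hco
    · refine (Subgroup.closure_le _).2 ?_
      rintro g ⟨a, ha, b, hb, hco, rfl⟩
      rw [← ih] at ha hb
      obtain ⟨a, ha, rfl⟩ := ha
      obtain ⟨b, hb, rfl⟩ := hb
      obtain ⟨s, hs, hs'⟩ := exists_pow_map_eq_of_prime_dvd f a
      obtain ⟨t, ht, ht'⟩ := exists_pow_map_eq_of_prime_dvd f b
      refine ⟨rightComm (a ^ s) (b ^ t), rightComm_mem_coprimeSeries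
        (Subgroup.pow_mem _ ha s) (Subgroup.pow_mem _ hb t) ?_, by rw [map_rightComm, hs, ht]⟩
      refine Nat.Coprime.symm (Nat.coprime_of_dvd fun q hq h1 h2 => ?_)
      have := Nat.dvd_gcd (hs' q hq h2) (ht' q hq h1)
      rw [hco.gcd_eq_one] at this
      exact hq.one_lt.ne' (Nat.dvd_one.1 this)

instance coprimeSeries_characteristic [Finite G] (n : ℕ) : (coprimeSeries G n).Characteristic :=
  Subgroup.characteristic_iff_map_eq.2 fun f => map_coprimeSeries f.toMonoidHom f.surjective n

theorem commute_of_coprimeSeries_succ_eq_bot {n : ℕ} (h : coprimeSeries G (n + 1) = ⊥)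
    (a b : coprimeSeries G n) (hco : (orderOf a).Coprime (orderOf b)) : a * b = b * a := by
  have := rightComm_mem_coprimeSeries a.2 b.2 (by simpa using hco)
  rw [h, Subgroup.mem_bot, rightComm_eq_one_iff] at this
  exact Subtype.ext this

end coprimeSeries

/-! ### Groups whose coprime elements commute -/

section CoprimeCommute

variable {G : Type*} [Group G] [Finite G]

/-- For `q ≠ p` a Sylow `q`-subgroup centralizes `P`, so no prime divides the index of the
normalizer of `P`. -/
theorem Sylow.normal_of_coprime_commute
    (h : ∀ a b : G, (orderOf a).Coprime (orderOf b) → a * b = b * a) {p : ℕ} [hp : Fact p.Prime]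
    (P : Sylow p G) : (P : Subgroup G).Normal := by
  rw [← Subgroup.normalizer_eq_top_iff, ← Subgroup.index_eq_one]
  by_contra hne
  obtain ⟨q, hq, hdvd⟩ := Nat.exists_prime_and_dvd hne
  have : Fact q.Prime := ⟨hq⟩
  let Q : Sylow q G := default
  by_cases hqp : q = p
  · subst hqp
    exact P.not_dvd_index (hdvd.trans (Subgroup.index_dvd_of_le Subgroup.le_normalizer))
  · refine Q.not_dvd_index (hdvd.trans (Subgroup.index_dvd_of_le ?_))
    refine Subgroup.le_normalizer_iff.2 fun y hy x hx => ?_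
    have hco : (orderOf y).Coprime (orderOf x) := by
      obtain ⟨i, hi⟩ := IsPGroup.iff_orderOf.1 Q.isPGroup' ⟨y, hy⟩
      obtain ⟨j, hj⟩ := IsPGroup.iff_orderOf.1 P.isPGroup' ⟨x, hx⟩
      rw [Subgroup.orderOf_mk] at hi hj
      rw [hi, hj]
      exact Nat.Coprime.pow _ _ ((Nat.coprime_primes hq hp.out).2 hqp)
    rw [h y x hco, mul_inv_cancel_right]
    exact hx

theorem isNilpotent_of_coprime_commute
    (h : ∀ a b : G, (orderOf a).Coprime (orderOf b) → a * b = b * a) : Group.IsNilpotent G :=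
  (Group.isNilpotent_of_finite_tfae.out 0 3 rfl rfl).2 fun _ _ P =>
    Sylow.normal_of_coprime_commute h P

theorem isNilpotent_deltaStar_of_coprimeSeries_eq_bot {n : ℕ} (h : coprimeSeries G (n + 1) = ⊥) :
    Group.IsNilpotent (deltaStar G n) := by
  refine isNilpotent_of_coprime_commute fun a b hco => ?_
  have := commute_of_coprimeSeries_succ_eq_bot h
    ⟨a, deltaStar_le_coprimeSeries n a.2⟩ ⟨b, deltaStar_le_coprimeSeries n b.2⟩ (by simpa using hco)
  have h' : (a : G) * b = b * a := congrArg (fun z : coprimeSeries G n => (z : G)) this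
  exact Subtype.ext h'

/-- If the terms after `coprimeSeries G n` vanish and `G` has no nontrivial normal `r`-subgroup,
then `coprimeSeries G n` has order prime to `r`. -/
theorem not_dvd_card_coprimeSeries {n r : ℕ} (hr : r.Prime) (h : coprimeSeries G (n + 1) = ⊥)
    (hO : ∀ K : Subgroup G, K.Normal → IsPGroup r K → K = ⊥) :
    ¬ r ∣ Nat.card (coprimeSeries G n) := by
  have : Fact r.Prime := ⟨hr⟩
  intro hdvd
  let S : Sylow r (coprimeSeries G n) := default
  have hn := S.normal_of_coprime_commute (commute_of_coprimeSeries_succ_eq_bot h)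
  have := S.characteristic_of_normal hn
  have h1 := hO ((S : Subgroup (coprimeSeries G n)).map (coprimeSeries G n).subtype) inferInstance
    (S.isPGroup'.map _)
  rw [Subgroup.map_eq_bot_iff_of_injective _ (Subgroup.subtype_injective _)] at h1
  exact S.ne_bot_of_dvd_card hdvd h1

end CoprimeCommute

/-! ### Towers, their kernels and their lifts -/

section Tower

variable {G : Type*} [Group G]

/-- A tower: a list of `p`-subgroups, each with its prime, in which every entry normalizes the later
ones and the primes of adjacent entries differ. -/
structure IsTower (L : List (ℕ × Subgroup G)) : Prop where
  prime : ∀ Q ∈ L, Q.1.Prime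
  isPGroup : ∀ Q ∈ L, IsPGroup Q.1 Q.2
  ne : L.IsChain fun Q R => Q.1 ≠ R.1
  normalizes : L.Pairwise fun Q R => Q.2 ≤ Subgroup.normalizer (R.2 : Set G)

theorem IsTower.tail {Q : ℕ × Subgroup G} {L : List (ℕ × Subgroup G)} (h : IsTower (Q :: L)) :
    IsTower L :=
  ⟨fun R hR => h.prime R (List.mem_cons_of_mem _ hR),
    fun R hR => h.isPGroup R (List.mem_cons_of_mem _ hR), h.ne.tail, h.normalizes.tail⟩

/-- The elements normalizing all entries of a list of subgroups. -/
def towerNormalizer (L : List (ℕ × Subgroup G)) : Subgroup G :=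
  ⨅ Q ∈ L, Subgroup.normalizer (Q.2 : Set G)

theorem mem_towerNormalizer {L : List (ℕ × Subgroup G)} {x : G} :
    x ∈ towerNormalizer L ↔ ∀ Q ∈ L, x ∈ Subgroup.normalizer (Q.2 : Set G) := by
  simp [towerNormalizer, Subgroup.mem_iInf]

theorem le_towerNormalizer {L : List (ℕ × Subgroup G)} {H : Subgroup G} :
    H ≤ towerNormalizer L ↔ ∀ Q ∈ L, H ≤ Subgroup.normalizer (Q.2 : Set G) := by
  simp [towerNormalizer]

theorem towerNormalizer_cons (Q : ℕ × Subgroup G) (L : List (ℕ × Subgroup G)) :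
    towerNormalizer (Q :: L) = Subgroup.normalizer (Q.2 : Set G) ⊓ towerNormalizer L := by
  ext x
  simp [mem_towerNormalizer, Subgroup.mem_inf]

/-- The elements whose iterated commutators with successive entries of the list end up in `E`. -/
def towerKer (E : Set G) : List (ℕ × Subgroup G) → Set G
  | [] => E
  | Q :: L => {x | ∀ u ∈ Q.2, rightComm u x ∈ towerKer E L}

/-- `towerKer` is only a set; cut down to the tower normalizer it is a subgroup, modulo which
coprime action can be applied. -/
theorem exists_subgroup_eq_towerKer {L : List (ℕ × Subgroup G)}
    (hL : L.Pairwise fun Q R => Q.2 ≤ Subgroup.normalizer (R.2 : Set G)) :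
    ∃ M : Subgroup G, (∀ x, x ∈ M ↔ x ∈ towerNormalizer L ∧ x ∈ towerKer {1} L) ∧
      towerNormalizer L ≤ Subgroup.normalizer (M : Set G) := by
  induction L with
  | nil =>
    refine ⟨⊥, fun x => ?_, ?_⟩
    · simp [mem_towerNormalizer, towerKer]
    · rw [Subgroup.normalizer_eq_top]
      exact le_top
  | cons Q L ih =>
    obtain ⟨M, hM, hn⟩ := ih hL.tail
    have hQ : Q.2 ≤ towerNormalizer L :=
      le_towerNormalizer.2 (List.pairwise_cons.1 hL).1
    have hconj : ∀ g ∈ towerNormalizer (Q :: L), ∀ z ∈ M, g * z * g⁻¹ ∈ M := fun g hg z hz => by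
      rw [towerNormalizer_cons] at hg
      exact (Subgroup.mem_normalizer_iff.1 (hn hg.2) z).1 hz
    have hker : ∀ x ∈ towerNormalizer (Q :: L),
        (x ∈ towerKer {1} (Q :: L) ↔ ∀ u ∈ Q.2, rightComm u x ∈ M) := fun x hx => by
      rw [towerNormalizer_cons] at hx
      refine forall₂_congr fun u hu => ?_
      rw [hM, and_iff_right (hQ (rightComm_mem_of_mem_normalizer hu hx.1))]
    refine ⟨{
      carrier := {x | x ∈ towerNormalizer (Q :: L) ∧ ∀ u ∈ Q.2, rightComm u x ∈ M}
      mul_mem' := ?_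
      one_mem' := ?_
      inv_mem' := ?_ }, ?_, ?_⟩
    · rintro x y ⟨hx, hx'⟩ ⟨hy, hy'⟩
      refine ⟨Subgroup.mul_mem _ hx hy, fun u hu => ?_⟩
      rw [show rightComm u (x * y) = rightComm u y * (y⁻¹ * rightComm u x * y⁻¹⁻¹) by
        simp [rightComm]; group]
      exact M.mul_mem (hy' u hu) (hconj _ (Subgroup.inv_mem _ hy) _ (hx' u hu))
    · refine ⟨Subgroup.one_mem _, fun u _ => ?_⟩
      rw [rightComm_eq_one_iff.2 (by simp)]
      exact M.one_mem
    · rintro x ⟨hx, hx'⟩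
      refine ⟨Subgroup.inv_mem _ hx, fun u hu => ?_⟩
      rw [show rightComm u x⁻¹ = x * (rightComm u x)⁻¹ * x⁻¹ by simp [rightComm]; group]
      exact hconj _ hx _ (M.inv_mem (hx' u hu))
    · intro x
      exact and_congr_right fun hx => (hker x hx).symm
    · refine Subgroup.le_normalizer_iff.2 ?_
      rintro g hg x ⟨hx, hx'⟩
      refine ⟨Subgroup.mul_mem _ (Subgroup.mul_mem _ hg hx) (Subgroup.inv_mem _ hg),
        fun u hu => ?_⟩
      rw [show rightComm u (g * x * g⁻¹) = g * rightComm (g⁻¹ * u * g⁻¹⁻¹) x * g⁻¹ by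
        simp [rightComm]; group]
      refine hconj g hg _ (hx' _ ?_)
      rw [towerNormalizer_cons] at hg
      exact (Subgroup.mem_normalizer_iff.1 (Subgroup.inv_mem _ hg.1) u).1 hu

theorem coprime_orderOf_of_isPGroup {p q : ℕ} (hp : p.Prime) (hq : q.Prime) (hpq : p ≠ q)
    {P Q : Subgroup G} (hP : IsPGroup p P) (hQ : IsPGroup q Q) {x y : G} (hx : x ∈ P)
    (hy : y ∈ Q) : (orderOf x).Coprime (orderOf y) := by
  have : Fact p.Prime := ⟨hp⟩
  have : Fact q.Prime := ⟨hq⟩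
  obtain ⟨i, hi⟩ := IsPGroup.iff_orderOf.1 hP ⟨x, hx⟩
  obtain ⟨j, hj⟩ := IsPGroup.iff_orderOf.1 hQ ⟨y, hy⟩
  rw [Subgroup.orderOf_mk] at hi hj
  rw [hi, hj]
  exact Nat.Coprime.pow _ _ ((Nat.coprime_primes hp hq).2 hpq)

/-- Under the hypothesis on orders, coprime `δ*ᵢ`-commutators act trivially on sufficiently long
towers. -/
theorem mem_towerKer_of_orderOf_mul [Finite G] {k : ℕ} (hk : 1 ≤ k)
    (h : ∀ a ∈ deltaStarCommutators G k, ∀ b ∈ deltaStarCommutators G k,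
      Nat.Coprime (orderOf a) (orderOf b) → orderOf (a * b) = orderOf a * orderOf b)
    {Q : ℕ × Subgroup G} {L : List (ℕ × Subgroup G)} (hL : IsTower (Q :: L)) {i : ℕ} {x : G}
    (hx : x ∈ towerNormalizer (Q :: L)) (hxi : x ∈ deltaStarCommutators G i)
    (hco : ∀ v ∈ Q.2, (orderOf x).Coprime (orderOf v)) (hlen : L.length + i = k) :
    x ∈ towerKer {1} (Q :: L) := by
  induction L generalizing Q i x with
  | nil =>
    intro u hu
    rw [towerNormalizer_cons] at hx
    obtain rfl : i = k := by simpa using hlen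
    exact rightComm_eq_one_of_orderOf_mul hk h hu hx.1 hxi hco
  | cons R L ih =>
    intro u hu
    rw [towerNormalizer_cons] at hx
    obtain ⟨M, hM, hn⟩ := exists_subgroup_eq_towerKer hL.tail.normalizes
    have hQ : Q.2 ≤ towerNormalizer (R :: L) :=
      le_towerNormalizer.2 (List.pairwise_cons.1 hL.normalizes).1
    have hy := engelComm_mem hu hx.1 (i + 1)
    have hker : engelComm u x (i + 1) ∈ towerKer {1} (R :: L) := by
      refine ih hL.tail (hQ hy) (engelComm_mem_deltaStarCommutators hu hx.1 hxi hco le_rfl) ?_ ?_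
      · intro v hv
        exact coprime_orderOf_of_isPGroup (hL.prime Q (by simp)) (hL.prime R (by simp))
          (List.isChain_cons_cons.1 hL.ne).1 (hL.isPGroup Q (by simp)) (hL.isPGroup R (by simp))
          hy hv
      · rw [← hlen, List.length_cons]
        ring
    exact ((hM _).1 (rightComm_mem_of_engelComm_mem hu hx.1 (hQ.trans hn) (hn hx.2) hco
      ((hM _).2 ⟨hQ hy, hker⟩))).2

theorem towerKer_subset_preimage {H : Type*} [Group H] (f : G →* H) {E : Set G} {F : Set H}
    (hEF : E ⊆ f ⁻¹' F) (L : List (ℕ × Subgroup G)) :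
    towerKer E L ⊆ f ⁻¹' towerKer F (L.map (Prod.map id (Subgroup.map f))) := by
  induction L with
  | nil => exact hEF
  | cons Q L ih =>
    rintro x hx _ ⟨u, hu, rfl⟩
    rw [← map_rightComm]
    exact ih (hx u hu)

theorem towerKer_append (E : Set G) (L L' : List (ℕ × Subgroup G)) :
    towerKer E (L ++ L') = towerKer (towerKer E L') L := by
  induction L with
  | nil => rfl
  | cons Q L ih => simp [towerKer, ih]

/-- Frattini argument: a `p`-subgroup of a quotient is the image of a `p`-subgroup whose normalizer
covers the given subgroup of the normalizer. -/
theorem exists_isPGroup_map_eq [Finite G] {H : Type*} [Group H] (f : G →* H) {p : ℕ}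
    [Fact p.Prime] {P K : Subgroup H} (hP : IsPGroup p P)
    (hK : K ≤ Subgroup.normalizer (P : Set H)) {J : Subgroup G} (hJ : J.map f = P ⊔ K) :
    ∃ S T : Subgroup G, IsPGroup p S ∧ S ≤ J ∧ T ≤ J ∧ T ≤ Subgroup.normalizer (S : Set G) ∧
      S.map f = P ∧ T.map f = K := by
  -- `M` is the preimage of `P` in `J`; a Sylow `p`-subgroup of `M` maps onto `P`, and Frattini
  -- gives `J = N_J(S) M`.
  let M : Subgroup J := (P.comap f).subgroupOf J
  have hPK : P ⊔ K ≤ Subgroup.normalizer (P : Set H) := sup_le Subgroup.le_normalizer hK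
  have hmem : ∀ j : J, j ∈ M ↔ f j ∈ P := fun j => Iff.rfl
  have hfJ : ∀ j : J, f j ∈ P ⊔ K := fun j => hJ ▸ Subgroup.mem_map_of_mem f j.2
  have hM : M.Normal := ⟨fun m hm j => by
    rw [hmem] at hm ⊢
    simpa using (Subgroup.mem_normalizer_iff.1 (hPK (hfJ j)) _).1 hm⟩
  let g : M →* P := ((f.comp J.subtype).comp M.subtype).codRestrict P fun m => m.2
  have hg : Function.Surjective g := by
    rintro ⟨y, hy⟩
    have hy' : y ∈ J.map f := hJ ▸ Subgroup.mem_sup_left hy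
    obtain ⟨j, hj, rfl⟩ := hy'
    exact ⟨⟨⟨j, hj⟩, hy⟩, rfl⟩
  let S : Sylow p M := default
  have hS : (S : Subgroup M).map g = ⊤ := by
    rw [← S.coe_mapSurjective hg]
    exact ((S.mapSurjective hg).3 (hP.to_subgroup ⊤) le_top).symm
  let S' : Subgroup J := (S : Subgroup M).map M.subtype
  have hsup : Subgroup.normalizer (S' : Set J) ⊔ M = ⊤ := S.normalizer_sup_eq_top
  have hSP : ∀ y ∈ P, ∃ s ∈ S', f s = y := fun y hy => by
    have hy' : (⟨y, hy⟩ : P) ∈ (S : Subgroup M).map g := hS ▸ Subgroup.mem_top _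
    obtain ⟨s, hs, hsy⟩ := hy'
    exact ⟨s, Subgroup.mem_map_of_mem _ hs, congrArg Subtype.val hsy⟩
  refine ⟨S'.map J.subtype, (Subgroup.normalizer (S' : Set J)).map J.subtype ⊓ K.comap f,
    (S.isPGroup'.map _).map _, Subgroup.map_subtype_le _,
    inf_le_left.trans (Subgroup.map_subtype_le _),
    inf_le_left.trans (Subgroup.le_normalizer_map _), ?_, ?_⟩
  · refine le_antisymm ?_ fun y hy => ?_
    · rintro _ ⟨_, ⟨_, ⟨m, -, rfl⟩, rfl⟩, rfl⟩
      exact m.2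
    · obtain ⟨s, hs, rfl⟩ := hSP y hy
      exact Subgroup.mem_map_of_mem f (Subgroup.mem_map_of_mem _ hs)
  · refine le_antisymm ?_ fun y hy => ?_
    · rintro _ ⟨t, ht, rfl⟩
      exact ht.2
    · have hy' : y ∈ J.map f := hJ ▸ Subgroup.mem_sup_right hy
      obtain ⟨j, hj, rfl⟩ := hy'
      have hj' : (⟨j, hj⟩ : J) ∈ Subgroup.normalizer (S' : Set J) ⊔ M := hsup ▸ Subgroup.mem_top _
      obtain ⟨n, hn, m, hm, hnm⟩ := Subgroup.mem_sup_of_normal_right.1 hj'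
      obtain ⟨s, hs, hsm⟩ := hSP (f m) hm
      -- The factor in `M` is replaced by an element of `S` with the same image, which keeps the
      -- product in the normalizer.
      have hns : f (J.subtype (n * s)) = f j := by
        have := congrArg (fun z : J => f z) hnm
        simp only [Subgroup.coe_mul, map_mul] at this
        simp [hsm, this]
      exact ⟨J.subtype (n * s), ⟨Subgroup.mem_map_of_mem _
        (Subgroup.mul_mem _ hn (Subgroup.le_normalizer hs)), Subgroup.mem_comap.2 (hns.symm ▸ hy)⟩,
        hns⟩

/-- Towers lift along surjective homomorphisms. -/
theorem exists_tower_map_eq [Finite G] {H : Type*} [Group H] (f : G →* H)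
    (hf : Function.Surjective f) {L : List (ℕ × Subgroup H)} (hL : IsTower L) {K : Subgroup H}
    (hK : K ≤ towerNormalizer L) :
    ∃ (L' : List (ℕ × Subgroup G)) (J : Subgroup G), IsTower L' ∧
      L'.map (Prod.map id (Subgroup.map f)) = L ∧ J ≤ towerNormalizer L' ∧ J.map f = K := by
  induction L generalizing K with
  | nil =>
    exact ⟨[], K.comap f, ⟨by simp, by simp, by simp, by simp⟩, rfl,
      le_towerNormalizer.2 (by simp), Subgroup.map_comap_eq_self_of_surjective hf K⟩
  | cons Q L ih =>
    rw [towerNormalizer_cons, le_inf_iff] at hK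
    have hQ : Q.2 ≤ towerNormalizer L :=
      le_towerNormalizer.2 (List.pairwise_cons.1 hL.normalizes).1
    -- Lifting for `Q.2 ⊔ K` leaves room in `J` for both the new entry and a cover of `K`.
    obtain ⟨L', J, hL', hmap, hJ, hJK⟩ := ih hL.tail (sup_le hQ hK.2)
    have : Fact Q.1.Prime := ⟨hL.prime Q (by simp)⟩
    obtain ⟨S, T, hS, hSJ, hTJ, hTS, hSQ, hTK⟩ :=
      exists_isPGroup_map_eq f (hL.isPGroup Q (by simp)) hK.1 hJK
    have hmap' : ((Q.1, S) :: L').map (Prod.map id (Subgroup.map f)) = Q :: L := by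
      simp [hmap, hSQ]
    refine ⟨(Q.1, S) :: L', T, ⟨?_, ?_, ?_, ?_⟩, hmap', ?_, hTK⟩
    · exact List.forall_mem_cons.2 ⟨hL.prime Q (by simp), hL'.prime⟩
    · exact List.forall_mem_cons.2 ⟨hS, hL'.isPGroup⟩
    · have hne := hL.ne
      rw [← hmap', List.isChain_map] at hne
      exact hne
    · exact List.pairwise_cons.2 ⟨le_towerNormalizer.1 (hSJ.trans hJ), hL'.normalizes⟩
    · rw [towerNormalizer_cons]
      exact le_inf hTS (hTJ.trans hJ)

end Tower

/-! ### Existence of acting towers -/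

section ActingTower

universe v

variable {G : Type v} [Group G]

/-- There is a tower with `n + 1` entries whose first entry does not act trivially down the tower,
and whose last prime differs from `r`. -/
def HasActingTower (G : Type*) [Group G] (n r : ℕ) : Prop :=
  ∃ (Q : ℕ × Subgroup G) (L : List (ℕ × Subgroup G)) (x : G), IsTower (Q :: L) ∧ L.length = n ∧
    x ∈ Q.2 ∧ x ∉ towerKer {1} L ∧ ∀ q ∈ ((Q :: L).map Prod.fst).getLast?, q ≠ r

theorem HasActingTower.of_succ {n r : ℕ} (h : HasActingTower G (n + 1) r) :
    HasActingTower G n r := by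
  obtain ⟨Q, L, x, hL, hlen, hx, hxL, hr⟩ := h
  obtain _ | ⟨R, L⟩ := L
  · simp at hlen
  · have hnot : ¬ ∀ u ∈ R.2, rightComm u x ∈ towerKer {1} L := hxL
    push Not at hnot
    obtain ⟨u, hu, hux⟩ := hnot
    refine ⟨R, L, _, hL.tail, by simpa using hlen, rightComm_mem_of_mem_normalizer hu
      ((List.pairwise_cons.1 hL.normalizes).1 R (by simp) hx), hux, ?_⟩
    rwa [List.map_cons, List.map_cons, List.getLast?_cons_cons] at hr

theorem HasActingTower.of_le {m n r : ℕ} (hmn : m ≤ n) (h : HasActingTower G n r) :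
    HasActingTower G m r := by
  induction hmn with
  | refl => exact h
  | step _ ih => exact ih h.of_succ

/-- Allowing any `E` inside the kernel of `f` lets a further entry be appended when `f` kills its
centralizer. -/
theorem exists_actingTower_map_eq [Finite G] {H : Type*} [Group H] (f : G →* H)
    (hf : Function.Surjective f) {Q : ℕ × Subgroup H} {L : List (ℕ × Subgroup H)} {x : H}
    (hL : IsTower (Q :: L)) (hx : x ∈ Q.2) (hxL : x ∉ towerKer {1} L) :
    ∃ (Q' : ℕ × Subgroup G) (L' : List (ℕ × Subgroup G)) (x' : G), IsTower (Q' :: L') ∧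
      (Q' :: L').map (Prod.map id (Subgroup.map f)) = Q :: L ∧ x' ∈ Q'.2 ∧
      ∀ E : Set G, E ⊆ f ⁻¹' {1} → x' ∉ towerKer E L' := by
  obtain ⟨L'', -, hL', hmap, -, -⟩ := exists_tower_map_eq f hf hL (bot_le (a := towerNormalizer _))
  obtain _ | ⟨Q', L'⟩ := L''
  · simp at hmap
  · have hmap' := hmap
    rw [List.map_cons, List.cons.injEq] at hmap
    obtain ⟨rfl, rfl⟩ := hmap
    obtain ⟨x', hx', rfl⟩ := hx
    exact ⟨Q', L', x', hL', hmap', hx', fun E hE hmem =>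
      hxL (towerKer_subset_preimage f hE L' hmem)⟩

theorem map_fst_map_prodMap_id {H : Type*} [Group H] (f : G →* H) (L : List (ℕ × Subgroup G)) :
    (L.map (Prod.map id (Subgroup.map f))).map Prod.fst = L.map Prod.fst := by
  rw [List.map_map]
  rfl

theorem HasActingTower.of_surjective [Finite G] {H : Type*} [Group H] (f : G →* H)
    (hf : Function.Surjective f) {n r : ℕ} (h : HasActingTower H n r) : HasActingTower G n r := by
  obtain ⟨Q, L, x, hL, hlen, hx, hxL, hr⟩ := h
  obtain ⟨Q', L', x', hL', hmap, hx', hxL'⟩ := exists_actingTower_map_eq f hf hL hx hxL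
  refine ⟨Q', L', x', hL', ?_, hx', hxL' _ (by simp), ?_⟩
  · have := congrArg List.length hmap
    simp at this
    omega
  · rwa [← map_fst_map_prodMap_id f, hmap]

/-- A normal `q`-subgroup can be appended to a tower coming from a quotient modulo its
centralizer. -/
theorem HasActingTower.append [Finite G] {H : Type*} [Group H] (f : G →* H)
    (hf : Function.Surjective f) {V : Subgroup G} [hVn : V.Normal] {q : ℕ} (hq : q.Prime)
    (hV : IsPGroup q V) (hfV : ∀ x, (∀ v ∈ V, rightComm v x = 1) → f x = 1) {n r : ℕ}
    (hqr : q ≠ r) (h : HasActingTower H n q) : HasActingTower G (n + 1) r := by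
  obtain ⟨Q, L, x, hL, hlen, hx, hxL, hr⟩ := h
  obtain ⟨Q', L', x', hL', hmap, hx', hxL'⟩ := exists_actingTower_map_eq f hf hL hx hxL
  rw [← hmap, map_fst_map_prodMap_id] at hr
  have hnV : Subgroup.normalizer (V : Set G) = ⊤ := Subgroup.normalizer_eq_top V
  refine ⟨Q', L' ++ [(q, V)], x', ?_, ?_, hx', ?_, ?_⟩
  · rw [← List.cons_append]
    refine ⟨?_, ?_, ?_, ?_⟩
    · simpa only [List.forall_mem_append, List.forall_mem_singleton] using ⟨hL'.prime, hq⟩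
    · simpa only [List.forall_mem_append, List.forall_mem_singleton] using ⟨hL'.isPGroup, hV⟩
    · refine List.isChain_append.2 ⟨hL'.ne, by simp, fun R hR S hS => ?_⟩
      obtain rfl : (q, V) = S := by simpa using hS
      exact hr R.1 (by rw [List.getLast?_map]; exact Option.mem_map_of_mem _ hR)
    · refine List.pairwise_append.2 ⟨hL'.normalizes, by simp, fun R _ S hS => ?_⟩
      obtain rfl : S = (q, V) := by simpa using hS
      simp [hnV]
  · have := congrArg List.length hmap
    simp at this ⊢
    omega
  · rw [towerKer_append]
    refine hxL' _ fun x hx => ?_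
    exact hfV x hx
  · rw [← List.cons_append, List.map_append, List.map_singleton, List.getLast?_concat]
    simpa using hqr

/-- Here `[a,b]` commutes with both `a` and `b`, so its order divides two coprime numbers. -/
theorem coprimeSeries_succ_eq_bot_of_le_centralizer {n : ℕ}
    (h : ∀ a ∈ coprimeSeries G n, ∀ c ∈ coprimeSeries G (n + 1), a * c = c * a) :
    coprimeSeries G (n + 1) = ⊥ := by
  rw [eq_bot_iff]
  refine (Subgroup.closure_le _).2 ?_
  rintro g ⟨a, ha, b, hb, hco, rfl⟩
  have key : ∀ a ∈ coprimeSeries G n, ∀ b ∈ coprimeSeries G n, (orderOf a).Coprime (orderOf b) →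
      orderOf (rightComm a b) ∣ orderOf b := fun a ha b hb hco =>
    orderOf_dvd_of_pow_eq_one (rightComm_pow_orderOf_eq_one (rightComm_eq_one_iff.2
      (h b hb _ (rightComm_mem_coprimeSeries ha hb hco)).symm))
  have h1 := key b hb a ha hco.symm
  rw [← rightComm_inv, orderOf_inv] at h1
  exact orderOf_eq_one_iff.1 (Nat.eq_one_of_dvd_coprimes hco h1 (key a ha b hb hco))

/-- A group acting faithfully by conjugation on a minimal normal `q`-subgroup has no nontrivial
normal `q`-subgroup. -/
theorem eq_bot_of_isPGroup_range_conjNormal [Finite G] {V : Subgroup G} [hVn : V.Normal]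
    {q : ℕ} [Fact q.Prime] (hq : q ∣ Nat.card V)
    (hmin : ∀ N : Subgroup G, N.Normal → N ≠ ⊥ → V ≤ N)
    (K : Subgroup (MulAut.conjNormal (H := V)).range) (hK : K.Normal) (hKq : IsPGroup q K) :
    K = ⊥ := by
  let ψ : K →* MulAut V := (Subgroup.subtype _).comp K.subtype
  -- A `q`-group acting on `V` fixes a point besides `1`; the fixed points `W` form a nontrivial
  -- normal subgroup of `G`, hence all of `V`.
  let _ : MulAction K V := MulAction.compHom V ψ
  have hsmul : ∀ (k : K) (v : V), k • v = ψ k v := fun _ _ => rfl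
  obtain ⟨b, hb, hb1⟩ := hKq.exists_fixed_point_of_prime_dvd_card_of_fixed_point V hq
    (a := 1) (fun k => by rw [hsmul, map_one])
  let W : Subgroup V :=
    { carrier := {v | ∀ k : K, ψ k v = v}
      mul_mem' := fun {x y} hx hy k => by rw [map_mul, hx k, hy k]
      one_mem' := fun k => map_one _
      inv_mem' := fun {x} hx k => by rw [map_inv, hx k] }
  have hWn : (W.map V.subtype).Normal := ⟨by
    rintro _ ⟨w, hw, rfl⟩ g
    refine ⟨MulAut.conjNormal g w, fun k => ?_, by simp⟩
    let γ : (MulAut.conjNormal (H := V)).range := ⟨MulAut.conjNormal g, g, rfl⟩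
    have h1 := hw ⟨γ⁻¹ * k * γ⁻¹⁻¹, hK.conj_mem k k.2 γ⁻¹⟩
    have h2 : ψ ⟨γ⁻¹ * k * γ⁻¹⁻¹, hK.conj_mem k k.2 γ⁻¹⟩ =
      (MulAut.conjNormal g)⁻¹ * ψ k * (MulAut.conjNormal g) := by simp [ψ, γ]
    rw [h2, MulAut.mul_apply, MulAut.mul_apply, MulAut.inv_apply, MulEquiv.symm_apply_eq] at h1
    exact h1⟩
  have hWV := hmin _ hWn fun hbot => hb1 (by
    have hbW : (b : G) ∈ W.map V.subtype := ⟨b, hb, rfl⟩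
    rw [hbot, Subgroup.mem_bot] at hbW
    exact (Subtype.ext hbW).symm)
  rw [eq_bot_iff]
  intro k hk
  rw [Subgroup.mem_bot]
  refine Subtype.ext (MulEquiv.ext fun v => ?_)
  obtain ⟨w, hw, hwv⟩ := hWV v.2
  obtain rfl : w = v := Subtype.ext hwv
  exact hw ⟨k, hk⟩

theorem isPGroup_of_minimal [Finite G] {V : Subgroup G} [hVn : V.Normal]
    (hcomm : ∀ a b : V, a * b = b * a) {q : ℕ} (hq : q.Prime) (hdvd : q ∣ Nat.card V)
    (hmin : ∀ N : Subgroup G, N.Normal → N ≠ ⊥ → V ≤ N) : IsPGroup q V := by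
  have : Fact q.Prime := ⟨hq⟩
  let S : Sylow q V := default
  have hn := S.normal_of_coprime_commute fun a b _ => hcomm a b
  have := S.characteristic_of_normal hn
  refine (S.isPGroup'.map V.subtype).to_le (hmin _ inferInstance fun hbot => ?_)
  rw [Subgroup.map_eq_bot_iff_of_injective _ (Subgroup.subtype_injective _)] at hbot
  exact S.ne_bot_of_dvd_card hdvd hbot

theorem exists_coprimeSeries_ne_bot_succ_eq_bot [Group.IsSolvable G] {m : ℕ}
    (h : coprimeSeries G m ≠ ⊥) :
    ∃ n, m ≤ n ∧ coprimeSeries G n ≠ ⊥ ∧ coprimeSeries G (n + 1) = ⊥ := by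
  classical
  have hex : ∃ n, coprimeSeries G n = ⊥ := by
    obtain ⟨n, hn⟩ := Group.IsSolvable.solvable (G := G)
    exact ⟨n, le_bot_iff.1 (hn ▸ coprimeSeries_le_derivedSeries n)⟩
  have hlt : m < Nat.find hex := by
    by_contra hle
    exact h (le_bot_iff.1 ((Nat.find_spec hex) ▸ coprimeSeries_antitone (not_lt.1 hle)))
  refine ⟨Nat.find hex - 1, by omega, Nat.find_min hex (by omega), ?_⟩
  rw [show Nat.find hex - 1 + 1 = Nat.find hex by omega]
  exact Nat.find_spec hex

/-- A finite soluble group in which the `n`-th term of the coprime series is nontrivial has a tower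
of height `n + 1`. -/
theorem hasActingTower_of_coprimeSeries_ne_bot [Finite G] [Group.IsSolvable G] {n r : ℕ}
    (h : coprimeSeries G n ≠ ⊥) (hr : ¬ r ∣ Nat.card (coprimeSeries G n)) :
    HasActingTower G n r := by
  induction hN : Nat.card G using Nat.strong_induction_on generalizing G n r with
  | _ N ih =>
  subst hN
  by_cases hquot : ∃ N : Subgroup G, ∃ _ : N.Normal, N ≠ ⊥ ∧ coprimeSeries (G ⧸ N) n ≠ ⊥
  · obtain ⟨N, hNn, hN, hNs⟩ := hquot
    have hmap := map_coprimeSeries (QuotientGroup.mk' N) (QuotientGroup.mk'_surjective N) n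
    refine HasActingTower.of_surjective _ (QuotientGroup.mk'_surjective N)
      (ih _ ?_ hNs (fun hd => hr (hd.trans ?_)) rfl)
    · rw [Subgroup.card_eq_card_quotient_mul_card_subgroup N]
      exact lt_mul_of_one_lt_right Nat.card_pos (Subgroup.one_lt_card_iff_ne_bot N |>.2 hN)
    · rw [← hmap]
      exact Subgroup.card_map_dvd _ _
  push Not at hquot
  -- No proper quotient sees the `n`-th term, so it is the unique minimal normal subgroup, hence an
  -- abelian `q`-group by solubility.
  have hmin : ∀ N : Subgroup G, N.Normal → N ≠ ⊥ → coprimeSeries G n ≤ N := fun N hNn hN => by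
    have hmap := map_coprimeSeries (QuotientGroup.mk' N) (QuotientGroup.mk'_surjective N) n
    rwa [hquot N hNn hN, Subgroup.map_eq_bot_iff, QuotientGroup.ker_mk'] at hmap
  have hcomm : ∀ a b : coprimeSeries G n, a * b = b * a := by
    have hlt := Group.IsSolvable.commutator_lt_of_ne_bot h
    have hbot : ⁅coprimeSeries G n, coprimeSeries G n⁆ = ⊥ := by
      by_contra hne
      exact hlt.not_ge (hmin _ inferInstance hne)
    intro a b
    have := Subgroup.commutator_eq_bot_iff_le_centralizer.1 hbot a.2
    exact Subtype.ext (Subgroup.mem_centralizer_iff.1 this b b.2).symm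
  obtain ⟨q, hq, hdvd⟩ := Nat.exists_prime_and_dvd (n := Nat.card (coprimeSeries G n))
    (by rwa [Ne, Subgroup.card_eq_one])
  have hqr : q ≠ r := by
    rintro rfl
    exact hr hdvd
  have : Fact q.Prime := ⟨hq⟩
  have hV := isPGroup_of_minimal hcomm hq hdvd hmin
  obtain _ | m := n
  · obtain ⟨x, hx, hx1⟩ := (Subgroup.bot_or_exists_ne_one _).resolve_left h
    exact ⟨(q, _), [], x, ⟨by simpa using hq, List.forall_mem_singleton.2 hV,
      by simp, by simp⟩, rfl, hx,
      by simpa [towerKer] using hx1, by simpa using hqr⟩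
  let φ : G →* MulAut (coprimeSeries G (m + 1)) := MulAut.conjNormal
  have hker : ∀ x, φ.rangeRestrict x = 1 ↔ ∀ v ∈ coprimeSeries G (m + 1), x * v = v * x := by
    intro x
    rw [Subtype.ext_iff, MonoidHom.coe_rangeRestrict, OneMemClass.coe_one, MulEquiv.ext_iff]
    simp only [Subtype.forall, Subtype.ext_iff, φ, MulAut.conjNormal_apply, MulAut.one_apply,
      mul_inv_eq_iff_eq_mul]
  have hsol : Group.IsSolvable φ.range := Group.isSolvable_of_surjective φ.rangeRestrict_surjective
  have hcard : Nat.card φ.range < Nat.card G := by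
    refine (Nat.card_le_card_of_surjective _ φ.rangeRestrict_surjective).lt_of_ne fun heq => h ?_
    have hinj := (Nat.bijective_iff_surjective_and_card φ.rangeRestrict).2
      ⟨φ.rangeRestrict_surjective, heq.symm⟩ |>.1
    refine (Subgroup.eq_bot_iff_forall _).2 fun x hx => hinj ?_
    rw [map_one, hker]
    exact fun v hv => congrArg Subtype.val (hcomm ⟨x, hx⟩ ⟨v, hv⟩)
  have hne : coprimeSeries φ.range m ≠ ⊥ := fun hbot => h <|
    coprimeSeries_succ_eq_bot_of_le_centralizer fun a ha => by
      rw [← hker, ← Subgroup.mem_bot, ← hbot,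
        ← map_coprimeSeries φ.rangeRestrict φ.rangeRestrict_surjective]
      exact Subgroup.mem_map_of_mem _ ha
  -- The last nontrivial term has order prime to `q`, so the tower from induction ends in a prime
  -- other than `q`; dropping its top entries leaves the length needed before appending.
  obtain ⟨M, hmM, hM, hM'⟩ := exists_coprimeSeries_ne_bot_succ_eq_bot hne
  have htower : HasActingTower φ.range M q := ih _ hcard hM
    (not_dvd_card_coprimeSeries hq hM' (eq_bot_of_isPGroup_range_conjNormal hdvd hmin)) rfl
  refine HasActingTower.append φ.rangeRestrict φ.rangeRestrict_surjective hq hV (fun x hx => ?_) hqr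
    (htower.of_le hmM)
  exact (hker x).2 fun v hv => (rightComm_eq_one_iff.1 (hx v hv)).symm

end ActingTower

theorem mainTheorem5 {G : Type*} [Group G] [Finite G] [Group.IsSolvable G] (k : ℕ) (hk : 1 ≤ k)
    (h : ∀ a ∈ deltaStarCommutators G k, ∀ b ∈ deltaStarCommutators G k,
      Nat.Coprime (orderOf a) (orderOf b) → orderOf (a * b) = orderOf a * orderOf b) :
    Group.IsNilpotent (deltaStar G k) := by
  refine isNilpotent_deltaStar_of_coprimeSeries_eq_bot ?_
  by_contra hne
  -- The value `r = 0` divides no positive order, so the condition on the last prime is vacuous.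
  obtain ⟨Q, L, x, hL, hlen, hx, hxL, -⟩ := hasActingTower_of_coprimeSeries_ne_bot (r := 0) hne
    (by simpa using Nat.card_pos.ne')
  obtain _ | ⟨R, L⟩ := L
  · simp at hlen
  · refine hxL (mem_towerKer_of_orderOf_mul (i := 0) hk h hL.tail
      (le_towerNormalizer.2 (List.pairwise_cons.1 hL.normalizes).1 hx) (Set.mem_univ x) ?_
      (by simpa using hlen))
    intro v hv
    exact coprime_orderOf_of_isPGroup (hL.prime Q (by simp)) (hL.prime R (by simp))
      (List.isChain_cons_cons.1 hL.ne).1 (hL.isPGroup Q (by simp)) (hL.isPGroup R (by simp)) hx hv
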